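/- Let $\Omega$ be a finite set with $n$ elements and let $f:2^\Omega\to\mathbb{R}$ be a set function. Its multilinear extension is the unique polynomial $F\in\mathbb{R}[x_i : i\in\Omega]$ of degree at most one in each variable with $F(1_S)=f(S)$ for all $S\subseteq\Omega$, where $1_S\in\{0,1\}^\Omega$ is the indicator vector of $S$. The degree of $f$ is the total degree of $F$ (with $\deg 0=0$). The function $f$ is submodular if $f(S)+f(T)\ge f(S\cup T)+f(S\cap T)$ for all $S,T\subseteq\Omega$. For $t\in\mathbb{N}=\{0,1,2,\dots\}$, the function $f$ is $t$-sos-submodular if for all $i\ne j$ in $\Omega$ there are finitely many polynomials $q_1,\dots,q_m$ of degree at most $t$ in the variables $x_{-i,j}=(x_k)_{k\in\Omega\setminus\{i,j\}}$ such that $$-\frac{\partial^2F}{\partial x_i\,\partial x_j}-\sum_{r=1}^m q_r^2$$ belongs to the ideal of $\mathbb{R}[x_{-i,j}]$ generated by the polynomials $x_k^2-x_k$, $k\in\Omega\setminus\{i,j\}$ (neither $x_i$ nor $x_j$ occurs in $\partial^2F/\partial x_i\partial x_j$). **Proposition.** Let $d,t\in\mathbb{N}$. 1. If $f:2^\Omega\to\mathbb{R}$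 has degree $d$ and $t<\left\lceil\frac{d-2}{2}\right\rceil$, then $f$ is not $t$-sos-submodular. 2. If $t=\max\left\{0,\left\lceil\frac{n+d-5}{2}\right\rceil\right\}$, then the set of $t$-sos-submodular functions $f:2^\Omega\to\mathbb{R}$ of degree $d$ is equal to the set of submodular functions $f:2^\Omega\to\mathbb{R}$ of degree $d$. -/

import Mathlib

namespace SosSubmod

open MvPolynomial

/-- A set function `f : 2^Ω → ℝ` on a finite set `Ω` is submodular if
`f(S) + f(T) ≥ f(S ∪ T) + f(S ∩ T)` for all `S, T ⊆ Ω`. -/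
def IsSubmodular {Ω : Type*} [DecidableEq Ω] (f : Finset Ω → ℝ) : Prop :=
  ∀ S T : Finset Ω, f (S ∪ T) + f (S ∩ T) ≤ f S + f T

/-- A polynomial is multilinear if every variable has degree at most one in every monomial. -/
def IsMultilinear {σ : Type*} (p : MvPolynomial σ ℝ) : Prop :=
  ∀ i : σ, p.degreeOf i ≤ 1

/-- The indicator vector `1_S ∈ {0,1}^Ω` of a set `S`. -/
def indicatorVec {Ω : Type*} [DecidableEq Ω] (S : Finset Ω) : Ω → ℝ :=
  fun i => if i ∈ S then 1 else 0

/-- The multilinear extension of a set function,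
`F(x) = ∑_T f(T) ∏_{i ∈ T} x_i ∏_{i ∉ T} (1 - x_i)`. By `mle_unique` below it is the unique
multilinear polynomial with `F(1_S) = f(S)` for all `S`. -/
noncomputable def mle {Ω : Type*} [Fintype Ω] [DecidableEq Ω] (f : Finset Ω → ℝ) :
    MvPolynomial Ω ℝ :=
  ∑ T : Finset Ω, C (f T) * ((∏ i ∈ T, X i) * ∏ i ∈ Tᶜ, (1 - X i))

/-- The degree of a set function is the (total) degree of its multilinear extension. -/
noncomputable def setDegree {Ω : Type*} [Fintype Ω] [DecidableEq Ω] (f : Finset Ω → ℝ) : ℕ :=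
  (mle f).totalDegree

/-- The ideal `⟨x_k² - x_k : k ∈ σ⟩` of `ℝ[x_k : k ∈ σ]`. -/
noncomputable def binaryIdeal (σ : Type*) : Ideal (MvPolynomial σ ℝ) :=
  Ideal.span (Set.range fun k : σ => X k ^ 2 - X k)

/-- `p` is `t`-sos modulo `I`: `p ≡ ∑ q_r² mod I` for finitely many polynomials `q_r` of degree
at most `t`. -/
def IsSosMod {σ : Type*} (t : ℕ) (I : Ideal (MvPolynomial σ ℝ)) (p : MvPolynomial σ ℝ) : Prop :=
  ∃ (m : ℕ) (q : Fin m → MvPolynomial σ ℝ),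
    (∀ r, (q r).totalDegree ≤ t) ∧ p - ∑ r, q r ^ 2 ∈ I

/-- The index set of the variables `x_{-i,j}`: all indices except `i` and `j`. -/
abbrev Rest {Ω : Type*} (i j : Ω) : Type _ := {k : Ω // k ≠ i ∧ k ≠ j}

/-- The second derivative `∂²F / ∂x_i ∂x_j` of the multilinear extension `F` of `f`, as an element
of `ℝ[x_{-i,j}]`. Neither `x_i` nor `x_j` occurs in it (see `rename_secondDeriv`), so that passing
to `ℝ[x_{-i,j}]` loses nothing. -/
noncomputable def secondDeriv {Ω : Type*} [Fintype Ω] [DecidableEq Ω] (f : Finset Ω → ℝ)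
    (i j : Ω) : MvPolynomial (Rest i j) ℝ :=
  killCompl (Subtype.val_injective (p := fun k : Ω => k ≠ i ∧ k ≠ j))
    (pderiv i (pderiv j (mle f)))

/-- `f` is `t`-sos-submodular if, for all `i ≠ j`, the polynomial `-∂²F / ∂x_i ∂x_j` is `t`-sos
in `ℝ[x_{-i,j}]` modulo the ideal `⟨x_k² - x_k : k ≠ i, j⟩`. -/
def IsSosSubmodular {Ω : Type*} [Fintype Ω] [DecidableEq Ω] (t : ℕ) (f : Finset Ω → ℝ) : Prop :=
  ∀ i j : Ω, i ≠ j → IsSosMod t (binaryIdeal (Rest i j)) (-secondDeriv f i j)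

theorem mle_isMultilinear {Ω : Type*} [Fintype Ω] [DecidableEq Ω] (f : Finset Ω → ℝ) :
    IsMultilinear (mle f) := by
  intro k
  unfold mle
  refine (degreeOf_sum_le _ _ _).trans (Finset.sup_le fun T _ => ?_)
  refine (degreeOf_C_mul_le _ _ _).trans ((degreeOf_mul_le _ _ _).trans ?_)
  have h1 : ∀ i : Ω, degreeOf k (X i : MvPolynomial Ω ℝ) ≤ if i = k then 1 else 0 := by
    intro i
    rw [degreeOf_X]
    by_cases h : k = i
    · simp [h]
    · simp [h]
  have h2 : ∀ i : Ω, degreeOf k (1 - X i : MvPolynomial Ω ℝ) ≤ if i = k then 1 else 0 := by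
    intro i
    have h3 : (1 - X i : MvPolynomial Ω ℝ) = 1 + C (-1) * X i := by simp [sub_eq_add_neg]
    rw [h3]
    refine (degreeOf_add_le _ _ _).trans (max_le ?_ ?_)
    · simp
    · exact (degreeOf_C_mul_le _ _ _).trans (h1 i)
  have h4 := (degreeOf_prod_le k T fun i => (X i : MvPolynomial Ω ℝ)).trans
    (Finset.sum_le_sum fun i _ => h1 i)
  have h5 := (degreeOf_prod_le k Tᶜ fun i => (1 - X i : MvPolynomial Ω ℝ)).trans
    (Finset.sum_le_sum fun i _ => h2 i)
  refine (add_le_add h4 h5).trans ?_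
  rw [Finset.sum_add_sum_compl]
  simp

theorem eval_mle {Ω : Type*} [Fintype Ω] [DecidableEq Ω] (f : Finset Ω → ℝ) (S : Finset Ω) :
    eval (indicatorVec S) (mle f) = f S := by
  unfold mle
  rw [map_sum, Finset.sum_eq_single S]
  · have h1 : ∏ i ∈ S, indicatorVec S i = 1 :=
      Finset.prod_eq_one fun i hi => by simp [indicatorVec, hi]
    have h2 : ∏ i ∈ Sᶜ, (1 - indicatorVec S i) = 1 :=
      Finset.prod_eq_one fun i hi => by simp [indicatorVec, Finset.mem_compl.1 hi]
    simp [map_prod, h1, h2]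
  · intro T _ hT
    by_cases h : T ⊆ S
    · obtain ⟨i, hiS, hiT⟩ := Finset.exists_of_ssubset (h.ssubset_of_ne hT)
      have h2 : ∏ i ∈ Tᶜ, (1 - indicatorVec S i) = 0 :=
        Finset.prod_eq_zero (Finset.mem_compl.2 hiT) (by simp [indicatorVec, hiS])
      simp [map_prod, h2]
    · obtain ⟨i, hiT, hiS⟩ := Finset.not_subset.1 h
      have h1 : ∏ i ∈ T, indicatorVec S i = 0 :=
        Finset.prod_eq_zero hiT (by simp [indicatorVec, hiS])
      simp [map_prod, h1]
  · simp

theorem mle_unique {Ω : Type*} [Fintype Ω] [DecidableEq Ω] (f : Finset Ω → ℝ)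
    (P : MvPolynomial Ω ℝ) (hP : IsMultilinear P)
    (h : ∀ S : Finset Ω, eval (indicatorVec S) P = f S) : P = mle f := by
  rw [← sub_eq_zero]
  refine eq_zero_of_eval_zero_at_prod_finset _ (fun _ => ({0, 1} : Finset ℝ)) ?_ ?_
  · intro i
    have h1 : (P - mle f) = P + C (-1) * mle f := by simp [sub_eq_add_neg]
    have h2 : ({0, 1} : Finset ℝ).card = 2 := Finset.card_pair zero_ne_one
    rw [h2, h1]
    refine Nat.lt_succ_of_le ((degreeOf_add_le _ _ _).trans (max_le (hP i) ?_))
    exact (degreeOf_C_mul_le _ _ _).trans (mle_isMultilinear f i)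
  · intro x hx
    have h1 : x = indicatorVec (Finset.univ.filter fun i => x i = 1) := by
      funext i
      have := hx i
      simp only [Finset.mem_insert, Finset.mem_singleton] at this
      rcases this with h | h <;> simp [indicatorVec, h]
    rw [map_sub, h1, h, eval_mle, sub_self]

/-- Neither `x_i` nor `x_j` occurs in `∂²F / ∂x_i ∂x_j`. -/
theorem rename_secondDeriv {Ω : Type*} [Fintype Ω] [DecidableEq Ω] (f : Finset Ω → ℝ) (i j : Ω) :
    rename Subtype.val (secondDeriv f i j) = pderiv i (pderiv j (mle f)) := by
  have key : ∀ m : Ω →₀ ℕ, m ∈ (pderiv i (pderiv j (mle f))).support → m i = 0 ∧ m j = 0 := by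
    intro m hm
    rw [mem_support_iff, coeff_pderiv, coeff_pderiv] at hm
    have h0 : coeff (m + Finsupp.single i 1 + Finsupp.single j 1) (mle f) ≠ 0 := by
      intro h
      simp [h] at hm
    have h1 := fun k => (monomial_le_degreeOf k (mem_support_iff.2 h0)).trans
      (mle_isMultilinear f k)
    have hi := h1 i
    have hj := h1 j
    simp only [Finsupp.add_apply, Finsupp.single_eq_same] at hi hj
    omega
  have hv : ((pderiv i (pderiv j (mle f))).vars : Set Ω) ⊆
      Set.range (Subtype.val : Rest i j → Ω) := by
    intro k hk
    obtain ⟨m, hm, hkm⟩ := (mem_vars k).1 (Finset.mem_coe.1 hk)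
    have h1 := key m hm
    have h2 := Finsupp.mem_support_iff.1 hkm
    refine ⟨⟨k, ?_, ?_⟩, rfl⟩
    · rintro rfl
      exact h2 h1.1
    · rintro rfl
      exact h2 h1.2
  obtain ⟨q, hq⟩ := exists_rename_eq_of_vars_subset_range _
    (Subtype.val : Rest i j → Ω) Subtype.val_injective hv
  unfold secondDeriv
  rw [← hq, killCompl_rename_app]

end SosSubmod

namespace SosSubmod

open MvPolynomial

/-! Submodularity means that each p = -∂²F/∂x_i∂x_j is nonnegative on a cube of dimension n - 2,
where p has degree at most d - 2. An sos certificate gives this by evaluation at the vertices.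

Lower bound (`not_isSosSubmodular`): some p contains a squarefree monomial of degree d - 2 > 2t,
which squares of degree at most 2t cannot cancel, and the Combinatorial Nullstellensatz then gives a
vertex where the difference is nonzero.

Upper bound (`isSosMod_of_nonneg`): let p ≥ 0 have degree r on a cube of dimension N. In the basis
of characters χ_A, multiplication by p has, up to scale, a positive semidefinite matrix that
vanishes when |A| and |B| differ by more than r. Cholesky elimination in order of increasing size
keeps this band (`exists_banded_cholesky`), so p is a sum of squares of combinations of χ_A with |K|
≤ |A| ≤ |K| + r. Such a combination has degree at most |K| + r; multiplied by the full character,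
whose square is 1 on the cube, it has degree at most N - |K|. These bounds add up to N + r ≤ 2t + 1,
so one of them is at most t. -/

/-! ### Banded Cholesky factorization -/

/-- A positive semidefinite symmetric matrix whose entries vanish when the weights of the indices
differ by more than `r` has a Cholesky factorization whose
columns are supported on windows of `r + 1` consecutive weights. -/
theorem exists_banded_cholesky {ι : Type*} [Fintype ι] [DecidableEq ι] (w : ι → ℕ) (r : ℕ)
    (M : ι → ι → ℝ) (hM : ∀ i j, M i j = M j i)
    (hpos : ∀ v : ι → ℝ, 0 ≤ ∑ i, ∑ j, v i * v j * M i j)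
    (hw : ∀ i j, w i + r < w j → M i j = 0) :
    ∃ L : ι → ι → ℝ, (∀ i j, M i j = ∑ k, L k i * L k j) ∧
        ∀ k i, L k i ≠ 0 → w k ≤ w i ∧ w i ≤ w k + r := by
  suffices H : ∀ n (s : Finset ι), s.card = n → ∀ M : ι → ι → ℝ, (∀ i j, M i j = M j i) →
      (∀ v : ι → ℝ, 0 ≤ ∑ i, ∑ j, v i * v j * M i j) →
      (∀ i j, i ∉ s → M i j = 0) → (∀ i j, w i + r < w j → M i j = 0) →
      ∃ L : ι → ι → ℝ, (∀ k, k ∉ s → L k = 0) ∧ (∀ i j, M i j = ∑ k, L k i * L k j) ∧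
        ∀ k i, L k i ≠ 0 → w k ≤ w i ∧ w i ≤ w k + r by
    obtain ⟨L, -, hL⟩ := H _ Finset.univ rfl M hM hpos
      (fun i _ h => absurd (Finset.mem_univ i) h) hw
    exact ⟨L, hL⟩
  clear hM hpos hw M
  intro n
  induction n with
  | zero =>
    intro s hs M _ _ h3 _
    rw [Finset.card_eq_zero] at hs
    subst hs
    exact ⟨0, by simp, fun i j => by simp [h3 i j], fun k i h => by simp at h⟩
  | succ n ih =>
    intro s hs M hsymm hpsd hsupp hband
    have hne : s.Nonempty := Finset.card_pos.1 (by omega)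
    -- Pivoting on an index of minimal weight makes the pivot row live on weights from `w k` to `w k
    -- + r`.
    obtain ⟨k, hk, hmin⟩ := s.exists_min_image w hne
    have hcard : (s.erase k).card = n := by rw [Finset.card_erase_of_mem hk]; omega
    have hquad : ∀ (v : ι → ℝ) (c : ℝ), ∑ i, ∑ j, (v i + (Pi.single k c : ι → ℝ) i) *
        (v j + (Pi.single k c : ι → ℝ) j) * M i j =
        ∑ i, ∑ j, v i * v j * M i j + 2 * c * ∑ i, v i * M k i + c ^ 2 * M k k := by
      intro v c
      have e : ∀ i j, (v i + (Pi.single k c : ι → ℝ) i) *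
          (v j + (Pi.single k c : ι → ℝ) j) * M i j =
          v i * v j * M i j + (Pi.single k c : ι → ℝ) i * (v j * M i j) +
          (v i * M i j) * (Pi.single k c : ι → ℝ) j +
          (Pi.single k c : ι → ℝ) i * ((Pi.single k c : ι → ℝ) j * M i j) := fun i j => by ring
      simp only [e, Finset.sum_add_distrib, ← Finset.mul_sum]
      simp only [Pi.single_apply, ite_mul, mul_ite, zero_mul, mul_zero, Finset.sum_ite_eq',
        Finset.mem_univ, if_true]
      have e2 : ∑ i, v i * M i k * c = c * ∑ i, v i * M k i := by
        rw [Finset.mul_sum]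
        exact Finset.sum_congr rfl fun i _ => by rw [hsymm i k]; ring
      rw [e2]
      ring
    have hkk : 0 ≤ M k k := by
      have h1 := hpsd (fun i => 0 + (Pi.single k 1 : ι → ℝ) i)
      have h2 := hquad 0 1
      simp only [Pi.zero_apply] at h2
      rw [h2] at h1
      simpa using h1
    rcases hkk.eq_or_lt with h0 | hpos
    · have hrow : ∀ j, M k j = 0 := by
        intro j
        by_contra hj
        have key : ∀ c : ℝ, 0 ≤ M j j + 2 * c * M k j := by
          intro c
          have h1 := hpsd (fun i => (Pi.single j 1 : ι → ℝ) i + (Pi.single k c : ι → ℝ) i)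
          rw [hquad, ← h0] at h1
          simpa [Pi.single_apply] using h1
        -- This c makes the right-hand side of `key` equal to -1.
        have := key (-(M j j + 1) / (2 * M k j))
        have e : 2 * (-(M j j + 1) / (2 * M k j)) * M k j = -(M j j + 1) := by
          field_simp
        linarith
      obtain ⟨L, hL0, hL1, hL2⟩ := ih (s.erase k) hcard M hsymm hpsd (by
        intro i j hi
        by_cases hik : i = k
        · rw [hik, hrow]
        · exact hsupp i j fun h => hi (Finset.mem_erase.2 ⟨hik, h⟩)) hband
      exact ⟨L, fun l hl => hL0 l fun h => hl (Finset.mem_of_mem_erase h), hL1, hL2⟩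
    · have hwin : ∀ j, M k j ≠ 0 → w k ≤ w j ∧ w j ≤ w k + r := by
        intro j hj
        refine ⟨hmin j ?_, ?_⟩
        · by_contra h
          exact hj (by rw [hsymm, hsupp j k h])
        · by_contra h
          exact hj (hband k j (by omega))
      obtain ⟨L, hL0, hL1, hL2⟩ := ih (s.erase k) hcard
        (fun i j => M i j - M k i * M k j / M k k)
        (fun i j => by rw [hsymm i j, mul_comm (M k i)]) (by
          intro v
          -- This multiple of the k-th unit vector minimizes the quadratic form; the minimum is the
          -- Schur complement evaluated at v.
          have h1 := hpsd (fun i => v i +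
            (Pi.single k (-(∑ i, v i * M k i) / M k k) : ι → ℝ) i)
          rw [hquad] at h1
          have e : ∑ i, ∑ j, v i * v j * (M i j - M k i * M k j / M k k) =
              ∑ i, ∑ j, v i * v j * M i j - (∑ i, v i * M k i) ^ 2 / M k k := by
            rw [sq, Finset.sum_mul_sum, Finset.sum_div]
            simp only [Finset.sum_div, ← Finset.sum_sub_distrib]
            exact Finset.sum_congr rfl fun i _ => Finset.sum_congr rfl fun j _ => by ring
          rw [e]
          refine h1.trans_eq ?_
          field_simp
          ring) (by
          intro i j hi
          by_cases hik : i = k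
          · subst hik
            field_simp
            ring
          · have hi' : i ∉ s := fun h => hi (Finset.mem_erase.2 ⟨hik, h⟩)
            rw [hsymm k i, hsupp i j hi', hsupp i k hi']
            simp) (by
          -- The correction term is nonzero only if i and j both lie in the pivot's window, where
          -- weights differ by at most r; so there is no fill-in outside the band.
          intro i j hij
          have h1 := hband i j hij
          by_cases hki : M k i = 0
          · simp [h1, hki]
          by_cases hkj : M k j = 0
          · simp [h1, hkj]
          have := hwin i hki
          have := hwin j hkj
          omega)
      refine ⟨Function.update L k fun i => M k i / √(M k k), ?_, ?_, ?_⟩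
      · intro l hl
        have hlk : l ≠ k := fun h => hl (h ▸ hk)
        rw [Function.update_of_ne hlk]
        exact hL0 l fun h => hl (Finset.mem_of_mem_erase h)
      · intro i j
        have h1 := hL1 i j
        have h2 : L k = 0 := hL0 k (by simp)
        rw [← Finset.add_sum_erase _ _ (Finset.mem_univ k), h2] at h1
        rw [← Finset.add_sum_erase _ _ (Finset.mem_univ k)]
        have e : ∑ l ∈ Finset.univ.erase k, Function.update L k (fun i => M k i / √(M k k)) l i *
            Function.update L k (fun i => M k i / √(M k k)) l j =
            ∑ l ∈ Finset.univ.erase k, L l i * L l j :=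
          Finset.sum_congr rfl fun l hl => by
            rw [Function.update_of_ne (Finset.ne_of_mem_erase hl)]
        rw [e]
        simp only [Function.update_self, Pi.zero_apply, mul_zero, zero_add] at h1 ⊢
        rw [← h1, div_mul_div_comm, Real.mul_self_sqrt hkk]
        ring
      · intro l i hli
        by_cases hlk : l = k
        · subst hlk
          rw [Function.update_self] at hli
          exact hwin i fun h => hli (by simp [h])
        · rw [Function.update_of_ne hlk] at hli
          exact hL2 l i hli

/-! ### Characters and sums of squares on the cube -/

section Cube

variable {σ : Type*}

/-- The sign `(-1)^{|{k} ∩ T|}`. -/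
def sign [DecidableEq σ] (T : Finset σ) (k : σ) : ℝ := if k ∈ T then -1 else 1

/-- The polynomial `∏_{k ∈ A} (1 - 2 x_k)`, which restricts to a character of the cube. -/
noncomputable def character (A : Finset σ) : MvPolynomial σ ℝ := ∏ k ∈ A, (1 - C 2 * X k)

theorem eval_character [DecidableEq σ] (A T : Finset σ) :
    eval (indicatorVec T) (character A) = ∏ k ∈ A, sign T k := by
  rw [character, map_prod]
  refine Finset.prod_congr rfl fun k _ => ?_
  by_cases h : k ∈ T <;> simp [indicatorVec, sign, h]
  norm_num

theorem totalDegree_character_le (A : Finset σ) : (character A).totalDegree ≤ A.card := by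
  refine (totalDegree_finsetProd _ _).trans ?_
  refine (Finset.sum_le_card_nsmul _ _ 1 fun k _ => ?_).trans (by simp)
  refine (totalDegree_sub _ _).trans (max_le (by simp) ?_)
  refine (totalDegree_mul _ _).trans ?_
  simp

theorem sign_mul_self [DecidableEq σ] (T : Finset σ) (k : σ) : sign T k * sign T k = 1 := by
  unfold sign
  split_ifs <;> norm_num

theorem prod_sign_mul_self [DecidableEq σ] (A T : Finset σ) :
    (∏ k ∈ A, sign T k) * (∏ k ∈ A, sign T k) = 1 := by
  rw [← Finset.prod_mul_distrib]
  exact Finset.prod_eq_one fun k _ => sign_mul_self T k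

theorem prod_sign_compl [Fintype σ] [DecidableEq σ] (A T : Finset σ) :
    ∏ k ∈ Aᶜ, sign T k = (∏ k, sign T k) * ∏ k ∈ A, sign T k := by
  rw [← Finset.prod_mul_prod_compl A, mul_right_comm, prod_sign_mul_self, one_mul]

theorem sum_prod_sign_mul [Fintype σ] [DecidableEq σ] (S T : Finset σ) :
    ∑ A : Finset σ, (∏ k ∈ A, sign S k) * (∏ k ∈ A, sign T k) =
      if S = T then 2 ^ Fintype.card σ else 0 := by
  simp only [← Finset.prod_mul_distrib]
  rw [← Finset.powerset_univ, ← Finset.prod_one_add]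
  split_ifs with h
  · subst h
    simp only [sign_mul_self]
    norm_num
  · obtain ⟨k, hk⟩ : ∃ k, ¬ (k ∈ S ↔ k ∈ T) := by
      by_contra! hc
      exact h (Finset.ext hc)
    refine Finset.prod_eq_zero (Finset.mem_univ k) ?_
    unfold sign
    by_cases h1 : k ∈ S <;> by_cases h2 : k ∈ T <;> simp_all

/-- A monomial of p involves at most deg p variables, so some k in B avoids both A and the monomial.
Flipping the membership of k in T negates the summand, and the terms cancel in pairs. This gives the
band condition for the Cholesky step. -/
theorem sum_eval_mul_sign_eq_zero [Fintype σ] [DecidableEq σ] (p : MvPolynomial σ ℝ) (A B : Finset σ)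
    (h : A.card + p.totalDegree < B.card) :
    ∑ T : Finset σ, eval (indicatorVec T) p * ((∏ k ∈ A, sign T k) * ∏ k ∈ B, sign T k) = 0 := by
  have e : ∀ T : Finset σ, eval (indicatorVec T) p =
      ∑ v ∈ p.support, coeff v p * ∏ k ∈ v.support, indicatorVec T k ^ v k := fun T => eval_eq _ _
  simp only [e, Finset.sum_mul]
  rw [Finset.sum_comm]
  refine Finset.sum_eq_zero fun v hv => ?_
  obtain ⟨k, hkB, hk⟩ : ∃ k ∈ B, k ∉ A ∪ v.support := by
    by_contra! hc
    have h1 := Finset.card_le_card (show B ⊆ A ∪ v.support from hc)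
    have h2 := Finset.card_union_le A v.support
    have h3 : v.support.card ≤ p.totalDegree := by
      refine le_trans ?_ (le_totalDegree hv)
      rw [Finset.card_eq_sum_ones]
      exact Finset.sum_le_sum fun i hi => Nat.one_le_iff_ne_zero.2 (Finsupp.mem_support_iff.1 hi)
    omega
  rw [Finset.mem_union, not_or] at hk
  have hmem : ∀ (T : Finset σ) (l : σ), l ≠ k → (l ∈ symmDiff T {k} ↔ l ∈ T) := by
    intro T l hl
    simp [Finset.mem_symmDiff, hl]
  refine Finset.sum_involution (fun T _ => symmDiff T {k}) ?_ ?_ ?_ ?_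
  · intro T _
    have h1 : ∏ l ∈ v.support, indicatorVec (symmDiff T {k}) l ^ v l =
        ∏ l ∈ v.support, indicatorVec T l ^ v l :=
      Finset.prod_congr rfl fun l hl => by
        simp only [indicatorVec, hmem T l (fun h => hk.2 (h ▸ hl))]
    have h2 : ∏ l ∈ A, sign (symmDiff T {k}) l = ∏ l ∈ A, sign T l :=
      Finset.prod_congr rfl fun l hl => by
        simp only [sign, hmem T l (fun h => hk.1 (h ▸ hl))]
    have h3 : ∏ l ∈ B, sign (symmDiff T {k}) l = - ∏ l ∈ B, sign T l := by
      rw [← Finset.mul_prod_erase B _ hkB, ← Finset.mul_prod_erase B _ hkB, ← neg_mul]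
      congr 1
      · by_cases hT : k ∈ T <;> simp [sign, Finset.mem_symmDiff, hT]
      · exact Finset.prod_congr rfl fun l hl => by
          simp only [sign, hmem T l (Finset.ne_of_mem_erase hl)]
    rw [h1, h2, h3]
    ring
  · intro T _ _ hT
    have := Finset.ext_iff.1 hT k
    by_cases hT : k ∈ T <;> simp [Finset.mem_symmDiff, hT] at this
  · simp
  · intro T _
    simp

theorem eval_eq_zero_of_mem_binaryIdeal {p : MvPolynomial σ ℝ} (hp : p ∈ binaryIdeal σ)
    {x : σ → ℝ} (hx : ∀ k, x k ∈ ({0, 1} : Finset ℝ)) : eval x p = 0 := by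
  have h : binaryIdeal σ ≤ RingHom.ker (eval x) := by
    refine Ideal.span_le.2 ?_
    rintro _ ⟨k, rfl⟩
    have := hx k
    simp only [Finset.mem_insert, Finset.mem_singleton] at this
    rcases this with h | h <;> simp [h]
  exact h hp

theorem indicatorVec_mem [DecidableEq σ] (T : Finset σ) (k : σ) : indicatorVec T k ∈ ({0, 1} : Finset ℝ) := by
  by_cases h : k ∈ T <;> simp [indicatorVec, h]

/-- By the Combinatorial Nullstellensatz, p is a combination of the products of X_k - c over c in
{0, 1}, which are the generators. -/
theorem mem_binaryIdeal_of_eval_eq_zero [Fintype σ] [DecidableEq σ] {p : MvPolynomial σ ℝ}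
    (hp : ∀ T : Finset σ, eval (indicatorVec T) p = 0) : p ∈ binaryIdeal σ := by
  obtain ⟨h, -, hh⟩ := combinatorial_nullstellensatz_exists_linearCombination
    (fun _ : σ => ({0, 1} : Finset ℝ)) (fun _ => by simp) p (by
      intro x hx
      have h1 : x = indicatorVec (Finset.univ.filter fun i => x i = 1) := by
        funext i
        have := hx i
        simp only [Finset.mem_insert, Finset.mem_singleton] at this
        rcases this with h | h <;> simp [indicatorVec, h]
      rw [h1, hp])
  rw [hh, Finsupp.linearCombination_apply]
  refine Ideal.sum_mem _ fun k _ => Ideal.mul_mem_left _ _ ?_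
  have e : ∏ r ∈ ({0, 1} : Finset ℝ), (X k - C r : MvPolynomial σ ℝ) = X k ^ 2 - X k := by
    rw [Finset.prod_pair zero_ne_one]
    simp only [map_zero, map_one]
    ring
  rw [e]
  exact Ideal.subset_span ⟨k, rfl⟩

/-- A polynomial that is nonnegative on the cube `{0,1}^σ` is a sum of squares of polynomials of
degree at most `t` modulo the ideal of the cube, as soon as `2t + 1 ≥ |σ| + deg p`. -/
theorem isSosMod_of_nonneg [Fintype σ] [DecidableEq σ] {p : MvPolynomial σ ℝ} {t : ℕ}
    (ht : Fintype.card σ + p.totalDegree ≤ 2 * t + 1)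
    (hp : ∀ T : Finset σ, 0 ≤ eval (indicatorVec T) p) : IsSosMod t (binaryIdeal σ) p := by
  have hsq : ∀ g : Finset σ → ℝ, (∑ A, g A) ^ 2 = ∑ A, ∑ B, g A * g B := fun g => by
    rw [sq, Finset.sum_mul_sum]
  obtain ⟨L, hL, hwin⟩ := exists_banded_cholesky Finset.card p.totalDegree
    (fun A B => ∑ T : Finset σ, eval (indicatorVec T) p *
      ((∏ k ∈ A, sign T k) * ∏ k ∈ B, sign T k))
    (fun A B => by simp only [mul_comm (∏ k ∈ A, _)]) (by
      intro v
      have e : ∑ A : Finset σ, ∑ B : Finset σ, v A * v B * ∑ T : Finset σ,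
          eval (indicatorVec T) p * ((∏ k ∈ A, sign T k) * ∏ k ∈ B, sign T k) =
          ∑ T : Finset σ, eval (indicatorVec T) p * (∑ A, v A * ∏ k ∈ A, sign T k) ^ 2 := by
        simp only [hsq, Finset.mul_sum]
        rw [Finset.sum_comm_cycle]
        refine Finset.sum_congr rfl fun T _ => ?_
        refine Finset.sum_congr rfl fun A _ => Finset.sum_congr rfl fun B _ => ?_
        ring
      rw [e]
      exact Finset.sum_nonneg fun T _ => mul_nonneg (hp T) (sq_nonneg _))
    (fun A B h => sum_eval_mul_sign_eq_zero p A B h)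
  have hN : (2 : ℝ) ^ Fintype.card σ ≠ 0 := by positivity
  -- Unfolding M = LᵀL leaves the squared character kernel, which by orthogonality is concentrated
  -- at S = T.
  have hval : ∀ T : Finset σ, ∑ K : Finset σ, (∑ A, L K A * ∏ k ∈ A, sign T k) ^ 2 =
      (2 ^ Fintype.card σ) ^ 2 * eval (indicatorVec T) p := by
    intro T
    calc ∑ K : Finset σ, (∑ A, L K A * ∏ k ∈ A, sign T k) ^ 2
        = ∑ A : Finset σ, ∑ B : Finset σ, (∑ K, L K A * L K B) *
            ((∏ k ∈ A, sign T k) * ∏ k ∈ B, sign T k) := by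
          simp only [hsq, Finset.sum_mul]
          symm
          rw [Finset.sum_comm_cycle]
          refine Finset.sum_congr rfl fun K _ => Finset.sum_congr rfl fun A _ =>
            Finset.sum_congr rfl fun B _ => ?_
          ring
      _ = ∑ S : Finset σ, eval (indicatorVec S) p *
            (∑ A : Finset σ, (∏ k ∈ A, sign S k) * ∏ k ∈ A, sign T k) ^ 2 := by
          simp only [← hL, hsq, Finset.sum_mul, Finset.mul_sum]
          rw [Finset.sum_comm_cycle]
          refine Finset.sum_congr rfl fun K _ => Finset.sum_congr rfl fun A _ =>
            Finset.sum_congr rfl fun B _ => ?_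
          ring
      _ = _ := by
          simp only [sum_prod_sign_mul]
          rw [Finset.sum_eq_single T (fun S _ hS => by simp [hS]) (by simp)]
          simp [mul_comm]
  -- Passing to complements multiplies the values by the full character, of square 1. If |K| + r >
  -- t, then N - |K| ≤ N + r - t - 1 ≤ t.
  let q : Finset σ → MvPolynomial σ ℝ := fun K => C ((2 ^ Fintype.card σ)⁻¹) *
    if K.card + p.totalDegree ≤ t then ∑ A, C (L K A) * character A
    else ∑ A, C (L K A) * character Aᶜ
  have hqdeg : ∀ K, (q K).totalDegree ≤ t := by
    intro K
    refine (totalDegree_mul _ _).trans ?_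
    rw [totalDegree_C, zero_add]
    split_ifs with hK
    all_goals
      refine totalDegree_finsetSum_le fun A _ => ?_
      by_cases hA : L K A = 0
      · simp [hA]
      have h1 := hwin K A hA
      refine (totalDegree_mul _ _).trans ?_
      rw [totalDegree_C, zero_add]
      refine (totalDegree_character_le _).trans ?_
    · omega
    · rw [Finset.card_compl]
      omega
  have hqeval : ∀ K T, eval (indicatorVec T) (q K) ^ 2 =
      ((2 ^ Fintype.card σ)⁻¹) ^ 2 * (∑ A, L K A * ∏ k ∈ A, sign T k) ^ 2 := by
    intro K T
    simp only [q]
    rw [map_mul, eval_C, mul_pow]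
    congr 1
    split_ifs with hK
    · simp only [map_sum, map_mul, eval_C, eval_character]
    · simp only [map_sum, map_mul, eval_C, eval_character, prod_sign_compl]
      simp only [mul_left_comm (L K _), ← Finset.mul_sum]
      rw [mul_pow, sq (∏ k, sign T k), prod_sign_mul_self, one_mul]
  let e := Fintype.equivFin (Finset σ)
  refine ⟨_, fun r => q (e.symm r), fun r => hqdeg _, mem_binaryIdeal_of_eval_eq_zero fun T => ?_⟩
  rw [e.symm.sum_comp fun K => q K ^ 2, map_sub, map_sum]
  simp only [map_pow, hqeval]
  rw [← Finset.mul_sum, hval]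
  field_simp
  ring

end Cube

/-! ### Second derivatives of the multilinear extension -/

theorem IsMultilinear.pderiv {σ : Type*} {p : MvPolynomial σ ℝ} (hp : IsMultilinear p) (i : σ) :
    IsMultilinear (MvPolynomial.pderiv i p) := by
  intro k
  refine degreeOf_le_iff.2 fun m hm => ?_
  rw [mem_support_iff, coeff_pderiv] at hm
  have h := (monomial_le_degreeOf k (mem_support_iff.2 (left_ne_zero_of_mul hm))).trans (hp k)
  rw [Finsupp.add_apply] at h
  omega

/-- The partial derivative of a multilinear polynomial is a difference of two values. -/
theorem IsMultilinear.eval_pderiv {σ : Type*} [Fintype σ] [DecidableEq σ] {p : MvPolynomial σ ℝ}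
    (hp : IsMultilinear p) (i : σ) (x : σ → ℝ) :
    eval x (MvPolynomial.pderiv i p) =
      eval (Function.update x i 1) p - eval (Function.update x i 0) p := by
  have hsplit : ∀ (y : σ → ℝ) (v : σ →₀ ℕ) (a : ℝ), eval y (monomial v a) =
      a * (y i ^ v i * ∏ k ∈ Finset.univ.erase i, y k ^ v k) := by
    intro y v a
    rw [eval_monomial, Finsupp.prod_fintype _ _ (fun k => pow_zero _),
      Finset.mul_prod_erase _ (fun k => y k ^ v k) (Finset.mem_univ i)]
  have hupd : ∀ (c : ℝ) (v : σ →₀ ℕ), ∏ k ∈ Finset.univ.erase i, Function.update x i c k ^ v k =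
      ∏ k ∈ Finset.univ.erase i, x k ^ v k := fun c v =>
    Finset.prod_congr rfl fun k hk => by rw [Function.update_of_ne (Finset.ne_of_mem_erase hk)]
  rw [p.as_sum]
  simp only [map_sum, ← Finset.sum_sub_distrib]
  refine Finset.sum_congr rfl fun v hv => ?_
  have hvi := (monomial_le_degreeOf i hv).trans (hp i)
  rw [pderiv_monomial]
  simp only [hsplit, hupd, Function.update_self]
  have h2 : ∏ k ∈ Finset.univ.erase i, x k ^ (v - Finsupp.single i 1 : σ →₀ ℕ) k =
      ∏ k ∈ Finset.univ.erase i, x k ^ v k :=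
    Finset.prod_congr rfl fun k hk => by
      simp [(Finset.ne_of_mem_erase hk).symm]
  rw [h2]
  interval_cases h : v i <;> simp [h]

theorem update_indicatorVec_one {Ω : Type*} [DecidableEq Ω] (S : Finset Ω) (i : Ω) :
    Function.update (indicatorVec S) i 1 = indicatorVec (insert i S) := by
  funext k
  by_cases h : k = i
  · subst h; simp [indicatorVec]
  · simp [indicatorVec, h]

theorem update_indicatorVec_zero {Ω : Type*} [DecidableEq Ω] (S : Finset Ω) (i : Ω) :
    Function.update (indicatorVec S) i 0 = indicatorVec (S.erase i) := by
  funext k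
  by_cases h : k = i
  · subst h; simp [indicatorVec]
  · simp [indicatorVec, h]

variable {Ω : Type*} [Fintype Ω] [DecidableEq Ω]

theorem eval_secondDeriv (f : Finset Ω → ℝ) {i j : Ω} (hij : i ≠ j) (T : Finset (Rest i j)) :
    eval (indicatorVec T) (secondDeriv f i j) =
      f (insert j (insert i (T.map (Function.Embedding.subtype _)))) -
      f (insert i (T.map (Function.Embedding.subtype _))) -
      (f (insert j (T.map (Function.Embedding.subtype _))) -
        f (T.map (Function.Embedding.subtype _))) := by
  set S : Finset Ω := T.map (Function.Embedding.subtype _) with hS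
  have hi : i ∉ S := by simp [hS]
  have hj : j ∉ S := by simp [hS]
  have h1 : indicatorVec T = indicatorVec S ∘ (Subtype.val : Rest i j → Ω) := by
    funext k
    have : k.1 ∈ S ↔ k ∈ T := by
      rw [hS]
      exact Finset.mem_map' (Function.Embedding.subtype _)
    simp [indicatorVec, this]
  rw [h1, ← eval_rename, rename_secondDeriv,
    ((mle_isMultilinear f).pderiv j).eval_pderiv, (mle_isMultilinear f).eval_pderiv,
    (mle_isMultilinear f).eval_pderiv]
  simp only [update_indicatorVec_one, update_indicatorVec_zero, eval_mle]
  rw [Finset.erase_eq_of_notMem hi, Finset.erase_eq_of_notMem hj,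
    Finset.erase_eq_of_notMem (by simp [hj, hij.symm] : j ∉ insert i S)]

theorem exists_coeff_of_mem_support_secondDeriv {f : Finset Ω → ℝ} {i j : Ω}
    {v : Rest i j →₀ ℕ} (hv : v ∈ (secondDeriv f i j).support) :
    v.mapDomain Subtype.val + Finsupp.single i 1 + Finsupp.single j 1 ∈ (mle f).support := by
  rw [mem_support_iff, ← coeff_rename_mapDomain _ Subtype.val_injective, rename_secondDeriv,
    coeff_pderiv, coeff_pderiv] at hv
  exact mem_support_iff.2 (left_ne_zero_of_mul (left_ne_zero_of_mul hv))

theorem totalDegree_secondDeriv_le (f : Finset Ω → ℝ) (i j : Ω) :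
    (secondDeriv f i j).totalDegree ≤ setDegree f - 2 := by
  refine Finset.sup_le fun v hv => ?_
  have h : (v.mapDomain Subtype.val + Finsupp.single i 1 + Finsupp.single j 1).degree ≤
    setDegree f := le_totalDegree (exists_coeff_of_mem_support_secondDeriv hv)
  rw [map_add, map_add, Finsupp.degree_mapDomain, Finsupp.degree_single,
    Finsupp.degree_single] at h
  change v.degree ≤ _
  omega

theorem secondDeriv_eq_zero {f : Finset Ω → ℝ} (hf : setDegree f < 2) (i j : Ω) :
    secondDeriv f i j = 0 := by
  rw [← support_eq_empty, Finset.eq_empty_iff_forall_notMem]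
  intro v hv
  have h : (v.mapDomain Subtype.val + Finsupp.single i 1 + Finsupp.single j 1).degree ≤
    setDegree f := le_totalDegree (exists_coeff_of_mem_support_secondDeriv hv)
  rw [map_add, map_add, Finsupp.degree_mapDomain, Finsupp.degree_single,
    Finsupp.degree_single] at h
  omega

/-- Some second derivative has a squarefree monomial of degree `deg f - 2`. -/
theorem exists_coeff_secondDeriv_ne_zero {f : Finset Ω → ℝ} (hf : 2 ≤ setDegree f) :
    ∃ i j : Ω, i ≠ j ∧ ∃ v : Rest i j →₀ ℕ, v.degree = setDegree f - 2 ∧ (∀ k, v k ≤ 1) ∧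
      coeff v (secondDeriv f i j) ≠ 0 := by
  have hne : (mle f).support.Nonempty := by
    rw [Finset.nonempty_iff_ne_empty, Ne, support_eq_empty]
    intro h
    simp [setDegree, h] at hf
  obtain ⟨u, hu, hmax⟩ := Finset.exists_mem_eq_sup _ hne fun s => s.sum fun _ e => e
  have hdeg : u.degree = setDegree f := hmax.symm
  have hu1 : ∀ k, u k ≤ 1 := fun k => (monomial_le_degreeOf k hu).trans (mle_isMultilinear f k)
  have hcard : 1 < u.support.card := by
    have : u.degree ≤ u.support.card := by
      rw [Finsupp.degree_apply]
      exact (Finset.sum_le_card_nsmul _ _ 1 fun k _ => hu1 k).trans (by simp)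
    omega
  obtain ⟨i, hi, j, hj, hij⟩ := Finset.one_lt_card.1 hcard
  rw [Finsupp.mem_support_iff] at hi hj
  -- Differentiating by two variables of a top-degree monomial `u` leaves a monomial of degree lower
  -- by exactly 2.
  have hle : Finsupp.single i 1 + Finsupp.single j 1 ≤ u := by
    intro k
    simp only [Finsupp.add_apply, Finsupp.single_apply]
    split_ifs <;> subst_vars <;> first | omega | exact absurd rfl hij
  obtain ⟨w, rfl⟩ := exists_add_of_le hle
  have hw : coeff w (rename Subtype.val (secondDeriv f i j)) ≠ 0 := by
    rw [rename_secondDeriv, coeff_pderiv, coeff_pderiv]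
    refine mul_ne_zero (mul_ne_zero ?_ (by positivity)) (by positivity)
    rw [add_assoc, add_comm]
    exact mem_support_iff.1 hu
  obtain ⟨v, hvw, hv⟩ := coeff_rename_ne_zero _ _ _ hw
  refine ⟨i, j, hij, v, ?_, fun k => ?_, hv⟩
  · rw [← hdeg, ← hvw, map_add, map_add, Finsupp.degree_mapDomain, Finsupp.degree_single,
      Finsupp.degree_single]
    omega
  · have := hu1 k.1
    rw [← hvw, Finsupp.add_apply, Finsupp.mapDomain_apply Subtype.val_injective] at this
    omega

/-! ### The degree obstruction -/

theorem not_isSosSubmodular {f : Finset Ω → ℝ} {t : ℕ} (ht : 2 * t + 2 < setDegree f) :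
    ¬ IsSosSubmodular t f := by
  intro h
  obtain ⟨i, j, hij, v, hvdeg, hv1, hv⟩ :=
    exists_coeff_secondDeriv_ne_zero (show 2 ≤ setDegree f by omega)
  obtain ⟨m, q, hq, hmem⟩ := h i j hij
  have hsum : (∑ r, q r ^ 2).totalDegree ≤ 2 * t :=
    totalDegree_finsetSum_le fun r _ =>
      (totalDegree_pow _ _).trans (Nat.mul_le_mul_left 2 (hq r))
  have hco : coeff v (-secondDeriv f i j - ∑ r, q r ^ 2) ≠ 0 := by
    rw [coeff_sub, coeff_neg, coeff_eq_zero_of_totalDegree_lt (f := ∑ r, q r ^ 2), sub_zero]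
    · exact neg_ne_zero.2 hv
    · rw [← Finsupp.degree_apply]
      omega
  -- The monomial `v` has top degree and exponents at most 1, so two values per variable suffice.
  obtain ⟨x, hx, hx0⟩ := combinatorial_nullstellensatz_exists_eval_nonzero _ v hco (by
    refine le_antisymm ?_ (le_totalDegree (mem_support_iff.2 hco))
    refine (totalDegree_sub _ _).trans (max_le ?_ (by omega))
    rw [totalDegree_neg, hvdeg]
    exact totalDegree_secondDeriv_le f i j) (fun _ => ({0, 1} : Finset ℝ)) (fun k => by
      rw [Finset.card_pair zero_ne_one]
      exact Nat.lt_succ_of_le (hv1 k))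
  exact hx0 (eval_eq_zero_of_mem_binaryIdeal hmem hx)

/-! ### Submodularity and sos-submodularity -/

/-- Submodularity can be checked on squares of the cube. -/
theorem isSubmodular_of_local {Ω : Type*} [DecidableEq Ω] {f : Finset Ω → ℝ}
    (h : ∀ (i j : Ω) (S : Finset Ω), i ≠ j → i ∉ S → j ∉ S →
      f (insert j (insert i S)) + f S ≤ f (insert i S) + f (insert j S)) : IsSubmodular f := by
  -- Diminishing returns: the marginal gain of i drops as D is added one element at a time. `step2`
  -- then telescopes over the elements of E.
  have step1 : ∀ (A D : Finset Ω) (i : Ω), i ∉ A → i ∉ D →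
      f (insert i (A ∪ D)) + f A ≤ f (insert i A) + f (A ∪ D) := by
    intro A D i hA hD
    induction D using Finset.induction_on with
    | empty => simp
    | insert a D ha ih =>
      rw [Finset.mem_insert, not_or] at hD
      have h1 := ih hD.2
      rw [Finset.union_insert]
      by_cases haA : a ∈ A ∪ D
      · rw [Finset.insert_eq_of_mem haA]
        exact h1
      · have := h a i (A ∪ D) (Ne.symm hD.1) haA (by simp [hA, hD.2])
        linarith
  have step2 : ∀ (A D E : Finset Ω), Disjoint E A → Disjoint E D →
      f (A ∪ D ∪ E) + f A ≤ f (A ∪ E) + f (A ∪ D) := by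
    intro A D E hA hD
    induction E using Finset.induction_on with
    | empty => simp [add_comm]
    | insert a E ha ih =>
      rw [Finset.disjoint_insert_left] at hA hD
      have h1 := ih hA.2 hD.2
      have h2 := step1 (A ∪ E) D a (by simp [hA.1, ha]) hD.1
      rw [Finset.union_insert, Finset.union_insert]
      rw [Finset.union_right_comm] at h1 ⊢
      linarith
  intro S T
  have h1 := step2 (S ∩ T) (S \ T) (T \ S)
    (Finset.disjoint_left.2 fun a ha hb => (Finset.mem_sdiff.1 ha).2 (Finset.mem_inter.1 hb).1)
    (Finset.disjoint_left.2 fun a ha hb => (Finset.mem_sdiff.1 ha).2 (Finset.mem_sdiff.1 hb).1)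
  have e1 : S ∩ T ∪ S \ T = S := by ext a; simp; tauto
  have e2 : S ∩ T ∪ T \ S = T := by ext a; simp; tauto
  have e3 : S ∪ T \ S = S ∪ T := by ext a; simp
  rw [e1, e2, e3] at h1
  linarith

theorem IsSosSubmodular.isSubmodular {f : Finset Ω → ℝ} {t : ℕ} (h : IsSosSubmodular t f) :
    IsSubmodular f := by
  refine isSubmodular_of_local fun i j S hij hi hj => ?_
  obtain ⟨m, q, -, hmem⟩ := h i j hij
  let T : Finset (Rest i j) := S.subtype _
  have hT : T.map (Function.Embedding.subtype _) = S :=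
    Finset.subtype_map_of_mem fun k hk => ⟨fun h => hi (h ▸ hk), fun h => hj (h ▸ hk)⟩
  have h1 := eval_eq_zero_of_mem_binaryIdeal hmem (indicatorVec_mem T)
  rw [map_sub, map_neg, eval_secondDeriv f hij, hT, map_sum] at h1
  have h2 : 0 ≤ ∑ r, eval (indicatorVec T) (q r ^ 2) :=
    Finset.sum_nonneg fun r _ => by rw [map_pow]; exact sq_nonneg _
  linarith

/-- The constant 5 comes from (n - 2) + (d - 2) ≤ 2t + 1. -/
theorem IsSubmodular.isSosSubmodular {f : Finset Ω → ℝ} (h : IsSubmodular f) {t : ℕ}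
    (ht : Fintype.card Ω + setDegree f ≤ 2 * t + 5) : IsSosSubmodular t f := by
  intro i j hij
  -- Here the truncated `setDegree f - 2` would be too large for the degree count, but the
  -- derivative is zero.
  by_cases hd : setDegree f < 2
  · rw [secondDeriv_eq_zero hd]
    exact ⟨0, Fin.elim0, fun r => r.elim0, by simp⟩
  have hcard : Fintype.card (Rest i j) + 2 ≤ Fintype.card Ω := by
    have h1 : Fintype.card {k : Ω // ¬ (k ≠ i ∧ k ≠ j)} =
        Fintype.card Ω - Fintype.card (Rest i j) := Fintype.card_subtype_compl (fun k : Ω => k ≠ i ∧ k ≠ j)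
    have h2 : Fintype.card {k : Ω // ¬ (k ≠ i ∧ k ≠ j)} = 2 := by
      rw [Fintype.card_subtype, ← Finset.card_pair hij]
      congr 1
      ext k
      simp
      tauto
    have h3 : Fintype.card (Rest i j) ≤ Fintype.card Ω := Fintype.card_subtype_le (fun k : Ω => k ≠ i ∧ k ≠ j)
    omega
  have hdeg := totalDegree_secondDeriv_le f i j
  refine isSosMod_of_nonneg (by rw [totalDegree_neg]; omega) fun T => ?_
  rw [map_neg, eval_secondDeriv f hij]
  set S : Finset Ω := T.map (Function.Embedding.subtype _) with hS
  have hi : i ∉ S := by simp [hS]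
  have hj : j ∉ S := by simp [hS]
  have h1 := h (insert i S) (insert j S)
  have e1 : insert i S ∪ insert j S = insert j (insert i S) := by
    ext a; simp
  have e2 : insert i S ∩ insert j S = S := by
    ext a
    simp only [Finset.mem_inter, Finset.mem_insert]
    constructor
    · rintro ⟨rfl | h, rfl | h'⟩ <;> first | assumption | exact absurd rfl hij
    · exact fun h => ⟨Or.inr h, Or.inr h⟩
  rw [e1, e2] at h1
  linarith

end SosSubmod

theorem mainTheorem2 {Ω : Type*} [Fintype Ω] [DecidableEq Ω] (d : ℕ) :
    (∀ (t : ℕ) (f : Finset Ω → ℝ), SosSubmod.setDegree f = d →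
      (t : ℤ) < ⌈((d : ℝ) - 2) / 2⌉ → ¬ SosSubmod.IsSosSubmodular t f) ∧
    (∀ t : ℕ, (t : ℤ) = max 0 ⌈((Fintype.card Ω : ℝ) + (d : ℝ) - 5) / 2⌉ →
      {f : Finset Ω → ℝ | SosSubmod.setDegree f = d ∧ SosSubmod.IsSosSubmodular t f} =
        {f : Finset Ω → ℝ | SosSubmod.setDegree f = d ∧ SosSubmod.IsSubmodular f}) := by

  constructor
  · intro t f hf ht
    refine SosSubmod.not_isSosSubmodular ?_
    rw [Int.lt_ceil] at ht
    rw [hf]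
    push_cast at ht
    have h : (2 * t + 2 : ℝ) < d := by linarith
    exact_mod_cast h
  · intro t ht
    ext f
    refine and_congr_right fun hf => ⟨fun h => h.isSubmodular, fun h => h.isSosSubmodular ?_⟩
    have h1 : ⌈((Fintype.card Ω : ℝ) + (d : ℝ) - 5) / 2⌉ ≤ (t : ℤ) := ht ▸ le_max_right _ _
    rw [Int.ceil_le] at h1
    push_cast at h1
    have h2 : (Fintype.card Ω + d : ℝ) ≤ 2 * t + 5 := by linarith
    rw [hf]
    exact_mod_cast h2
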